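/- **Proposition 1.** Let $\lambda_b, R_{\max}, r_0>0$, and let the base stations (BSs) form a Poisson point process in the plane of density $\lambda_b$ on the disk $\mathcal A=\boldsymbol b(\boldsymbol o,R_{\max})$ and with no points outside it. Let $p_B:[0,\infty)\to[0,1]$ be a measurable function (for instance $p_B(l)=1-e^{-\lambda (l-r_B)^+ r_B}$ with $\lambda,r_B\ge 0$). Consider a mobile user (MU) at distance $r$ from the origin, $0\le r\le R_{\max}$; conditionally on the BS locations, each BS is line-of-sight (LOS) independently of the others, with probability $1-p_B(l)$ if its distance to the MU is $l$. For $R_{\max}-r<l<R_{\max}+r$ put $$\delta(l,r)=\tfrac14\sqrt{(r+R_{\max}+l)(r+R_{\max}-l)(r-R_{\max}+l)(-r+R_{\max}+l)},$$ $$x_{1,2}(l,r)=\pm\frac{2\delta(l,r)}{r},\qquad y_1(l,r)=y_2(l,r)=\frac r2+\frac{R_{\max}^2-l^2}{2r},\qquad m_i(l,r)=\frac{y_i-r}{x_i}\quad(i=1,2),$$ $$\theta(l,r)=\pi+\tan^{-1}m_1-\tan^{-1}m_2 ,$$ and put $\theta(l,r)=0$ for $l\ge R_{\max}+r$. Let $C(l,r)=\theta(l,r)\,l$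 for $l>R_{\max}-r$. Then: 1. For $R_{\max}-r<l<R_{\max}+r$ the circle of radius $R_{\max}$ about the origin and the circle of radius $l$ about $(0,r)$ meet exactly in the points $(x_1,y_1)$ and $(x_2,y_2)$; moreover $\theta(l,r)\in(0,2\pi)$, and $\tan\theta(l,r)=\frac{m_1-m_2}{1+m_1m_2}$ whenever $1+m_1m_2\neq0$. 2. The length of the part of the circle of radius $l$ about the MU that lies in $\mathcal A$ is $2\pi l$ if $0\le l\le R_{\max}-r$, and $C(l,r)$ if $l>R_{\max}-r$. 3. The probability that the MU has at least one LOS BS within distance $r_0$ is $$B_L(r)=\begin{cases}1-\exp\Big(-2\pi\lambda_b\int_0^{r_0}v(1-p_B(v))\,dv\Big) & \text{if } 0\le r\le R_{\max}-r_0,\\[1mm] 1-\exp\Big(-\lambda_b\Big[2\pi\int_0^{R_{\max}-r}v(1-p_B(v))\,dv+\int_{R_{\max}-r}^{r_0}C(v,r)(1-p_B(v))\,dv\Big]\Big) & \text{otherwise.}\end{cases}$$ 4. If $B_L(r)>0$ then, conditionally on the event that the MU has an LOS BS within distance $r_0$, the distance from the MU to the nearest LOS BS has the probability density, on $0\le l\le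 r_0$, $$f_L(l,r)=\begin{cases}\dfrac{2\pi l\lambda_b(1-p_B(l))}{B_L(r)}\exp\Big(-2\pi\lambda_b\int_0^{l}v(1-p_B(v))\,dv\Big) & \text{if } 0\le r\le R_{\max}-r_0 \text{ or } 0\le l\le R_{\max}-r,\\[2mm] \dfrac{\lambda_bC(l,r)(1-p_B(l))}{B_L(r)}\exp\Big(-\lambda_b\Big[2\pi\int_0^{R_{\max}-r}v(1-p_B(v))\,dv+\int_{R_{\max}-r}^{l}C(v,r)(1-p_B(v))\,dv\Big]\Big) & \text{otherwise.}\end{cases}$$ -/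

import Mathlib

open MeasureTheory ProbabilityTheory
open scoped ENNReal

noncomputable section

namespace MmWave

/-- The plane with its Euclidean norm. -/
abbrev Plane : Type := EuclideanSpace ℝ (Fin 2)

/-! ### Point processes with finitely many points, and their marks

A point process with finitely many points is given by the number `N` of points and an enumeration
`X 0, …, X (N - 1)` of them; the values `X i` with `i ≥ N` play no role. -/

/-- The number of points that lie in the set `A`. -/
def count {Ω E : Type*} (N : Ω → ℕ) (X : ℕ → Ω → E) (A : Set E) (ω : Ω) : ℕ :=
  Set.ncard {i : ℕ | i < N ω ∧ X i ω ∈ A}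

/-- The points `X 0, …, X (N - 1)` form a Poisson point process with finite intensity measure
`Λ`: the number of points in a measurable set `A` has the Poisson law of mean `Λ A`, and the
numbers of points in pairwise disjoint measurable sets are independent. -/
structure IsPoissonProcess {Ω E : Type*} [MeasurableSpace Ω] [MeasurableSpace E]
    (μ : Measure Ω) (N : Ω → ℕ) (X : ℕ → Ω → E) (Λ : Measure E) : Prop where
  measurable_number : Measurable N
  measurable_point : ∀ i, Measurable (X i)
  map_count : ∀ A : Set E, MeasurableSet A →
    μ.map (count N X A) = poissonMeasure (Λ A).toNNReal
  indep_count : ∀ (k : ℕ) (A : Fin k → Set E), (∀ j, MeasurableSet (A j)) →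
    Pairwise (fun i j => Disjoint (A i) (A j)) →
    iIndepFun (fun j => count N X (A j)) μ

/-- Conditionally on the points, the marks `M 0, …, M (N - 1)` are independent and `M i` is `true`
with probability `q (X i)`. -/
structure IsIndependentMarking {Ω E : Type*} [MeasurableSpace Ω] [MeasurableSpace E]
    (μ : Measure Ω) (N : Ω → ℕ) (X : ℕ → Ω → E) (q : E → ℝ) (M : ℕ → Ω → Bool) : Prop where
  measurable_mark : ∀ i, Measurable (M i)
  joint_law : ∀ (n : ℕ) (B : Set (Fin n → E)) (s : Fin n → Bool), MeasurableSet B →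
    μ {ω | N ω = n ∧ (fun i : Fin n => X i ω) ∈ B ∧ ∀ i : Fin n, M i ω = s i} =
      ∫⁻ ω in {ω | N ω = n ∧ (fun i : Fin n => X i ω) ∈ B},
        ∏ i : Fin n, ENNReal.ofReal (if s i = true then q (X i ω) else 1 - q (X i ω)) ∂μ

/-! ### Blockage -/

/-- `pB l` is the blockage probability of a link of length `l ≥ 0`. -/
structure IsBlockageProfile (pB : ℝ → ℝ) : Prop where
  measurable : Measurable pB
  mem_Icc : ∀ l, 0 ≤ l → pB l ∈ Set.Icc (0 : ℝ) 1

/-- The blockage probability `1 - exp (-lam (l - rB) rB)` caused by blockers of density `lam` and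
radius `rB`; a link shorter than `rB` is not blocked. -/
def blockageProb (lam rB l : ℝ) : ℝ :=
  1 - Real.exp (-(lam * max (l - rB) 0 * rB))

theorem isBlockageProfile_blockageProb {lam rB : ℝ} (hlam : 0 ≤ lam) (hrB : 0 ≤ rB) :
    IsBlockageProfile (blockageProb lam rB) where
  measurable := by unfold blockageProb; fun_prop
  mem_Icc l _ := by
    have h : 0 ≤ lam * max (l - rB) 0 * rB :=
      mul_nonneg (mul_nonneg hlam (le_max_right _ _)) hrB
    have h1 : Real.exp (-(lam * max (l - rB) 0 * rB)) ≤ 1 :=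
      Real.exp_le_one_iff.mpr (neg_nonpos.mpr h)
    have h2 := Real.exp_pos (-(lam * max (l - rB) 0 * rB))
    constructor <;> unfold blockageProb <;> linarith

/-! ### The nearest line-of-sight base station -/

/-- The distances from `u` to the base stations with mark `true` (line of sight). -/
def losDistances {Ω : Type*} (N : Ω → ℕ) (X : ℕ → Ω → Plane) (LOS : ℕ → Ω → Bool) (u : Plane)
    (ω : Ω) : Set ℝ :=
  {d | ∃ i, i < N ω ∧ LOS i ω = true ∧ dist u (X i ω) = d}

/-- The event that some line-of-sight base station lies within distance `r₀` of `u`. -/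
def losInRange {Ω : Type*} (N : Ω → ℕ) (X : ℕ → Ω → Plane) (LOS : ℕ → Ω → Bool) (u : Plane)
    (r₀ : ℝ) : Set Ω :=
  {ω | ∃ d ∈ losDistances N X LOS u ω, d ≤ r₀}

/-- The distance from `u` to the nearest line-of-sight base station. The infimum is over a finite
set, so it is a minimum whenever such a base station exists. -/
def nearestLosDist {Ω : Type*} (N : Ω → ℕ) (X : ℕ → Ω → Plane) (LOS : ℕ → Ω → Bool) (u : Plane)
    (ω : Ω) : ℝ :=
  sInf (losDistances N X LOS u ω)

/-! ### The geometry of two circles -/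

/-- The length of the part of the circle of centre `u` and radius `l` that lies in the disk of
centre `0` and radius `R`: the circle is parametrized by the angle, and the length is `l` times
the measure of the set of admissible angles. -/
def arcLengthInDisk (R : ℝ) (u : Plane) (l : ℝ) : ℝ :=
  l * volume.real {φ : ℝ | φ ∈ Set.Ioc (-Real.pi) Real.pi ∧
    u + l • (!₂[Real.cos φ, Real.sin φ] : Plane) ∈ Metric.closedBall (0 : Plane) R}

/-- The area of a triangle with sides `r`, `R`, `l`. -/
def delta (R l r : ℝ) : ℝ :=
  √((r + R + l) * (r + R - l) * (r - R + l) * (-r + R + l)) / 4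

/-- The abscissas of the two intersection points of the circle of centre `0` and radius `R` with
the circle of centre `(0, r)` and radius `l`. -/
def x₁ (R l r : ℝ) : ℝ := 2 * delta R l r / r

def x₂ (R l r : ℝ) : ℝ := -(2 * delta R l r / r)

/-- The common ordinate of the two intersection points. -/
def y₁₂ (R l r : ℝ) : ℝ := r / 2 + (R ^ 2 - l ^ 2) / (2 * r)

/-- The slopes of the lines from `(0, r)` to the two intersection points. -/
def m₁ (R l r : ℝ) : ℝ := (y₁₂ R l r - r) / x₁ R l r

def m₂ (R l r : ℝ) : ℝ := (y₁₂ R l r - r) / x₂ R l r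

/-- The angle of the arc inside the disk. For `R - r < l < R + r` it is the branch in `(0, 2π)` of
`arctan ((m₁ - m₂) / (1 + m₁ m₂))` that is continuous in `l`; for `l ≥ R + r` no arc is left. -/
def theta (R l r : ℝ) : ℝ :=
  if l < R + r then Real.pi + Real.arctan (m₁ R l r) - Real.arctan (m₂ R l r) else 0

/-- The length of the arc of angle `theta`. -/
def C (R l r : ℝ) : ℝ := theta R l r * l

/-! ### The density -/

/-- The probability of a line-of-sight base station within range `r₀`. -/
def B_L (lamb R r₀ : ℝ) (pB : ℝ → ℝ) (r : ℝ) : ℝ :=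
  if r ≤ R - r₀ then
    1 - Real.exp (-(2 * Real.pi * lamb * ∫ v in (0 : ℝ)..r₀, v * (1 - pB v)))
  else
    1 - Real.exp (-(lamb * ((2 * Real.pi * ∫ v in (0 : ℝ)..(R - r), v * (1 - pB v)) +
      ∫ v in (R - r)..r₀, C R v r * (1 - pB v))))

/-- The density of the distance to the nearest line-of-sight base station, for a user at distance
`r` from the origin. -/
def f_L (lamb R r₀ : ℝ) (pB : ℝ → ℝ) (l r : ℝ) : ℝ :=
  if r ≤ R - r₀ ∨ l ≤ R - r then
    2 * Real.pi * l * lamb * (1 - pB l) *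
      Real.exp (-(2 * Real.pi * lamb * ∫ v in (0 : ℝ)..l, v * (1 - pB v))) / B_L lamb R r₀ pB r
  else
    lamb * C R l r * (1 - pB l) *
      Real.exp (-(lamb * ((2 * Real.pi * ∫ v in (0 : ℝ)..(R - r), v * (1 - pB v)) +
        ∫ v in (R - r)..l, C R v r * (1 - pB v)))) / B_L lamb R r₀ pB r

end MmWave

end

/-!
Summing over the number of points and expanding simple functions identifies the generating
functional of a Poisson process of finite intensity `Λ` as `∫ ∏ᵢ g (X i) = exp (∫ (g - 1) dΛ)`.
Integrating out independent marks of probability `q` over the event that no point of `S` is marked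
leaves the factor `1 - q` for each point of `S`, so that event has probability `exp (-∫ x in S, q)`.

For the disk and `q x = 1 - p_B (dist u x)`, polar coordinates around the user turn the integral
over a ball into one over the distance `v`, with weight the length of the arc of radius `v` inside
the disk. The nearest line-of-sight distance thus has distribution function `1 - exp (-∫₀ᵗ k)` for
the hazard rate `k = losRate`, and the density `k l * exp (-∫₀ˡ k)` comes from the fundamental
theorem of calculus for absolutely continuous functions, as `k` is only integrable.

The arc itself consists of the angles whose cosine, after a rotation, is at most the value `c`
given by the law of cosines (`cosAngle`), so its angle is `2π - 2 arccos c`, which is `theta`.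
-/

namespace MmWave

section PoissonProcess

open Filter Topology

variable {Ω E : Type*} [MeasurableSpace E]

theorem integral_pow_poissonMeasure (a : NNReal) (c : ℝ) :
    ∫ n, c ^ n ∂poissonMeasure a = Real.exp (a * (c - 1)) := by
  rw [integral_poissonMeasure]
  calc ∑' n : ℕ, (Real.exp (-a) * (a : ℝ) ^ n / n.factorial) • c ^ n
      = ∑' n : ℕ, Real.exp (-a) * ((a * c) ^ n / n.factorial) := by
        congr 1 with n
        rw [smul_eq_mul, mul_pow]
        ring
    _ = Real.exp (-a) * Real.exp (a * c) := by
        rw [tsum_mul_left, Real.exp_eq_exp_ℝ, NormedSpace.exp_eq_tsum_div]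
    _ = Real.exp (a * (c - 1)) := by
        rw [← Real.exp_add]
        ring_nf

theorem prod_range_eq_prod_pow_count (N : Ω → ℕ) (X : ℕ → Ω → E) (g : SimpleFunc E ℝ) (ω : Ω) :
    ∏ i ∈ Finset.range (N ω), g (X i ω) = ∏ c ∈ g.range, c ^ count N X (g ⁻¹' {c}) ω := by
  classical
  rw [← Finset.prod_fiberwise_of_maps_to fun i _ => SimpleFunc.mem_range_self g (X i ω)]
  refine Finset.prod_congr rfl fun c _ => ?_
  rw [Finset.prod_congr rfl fun i hi => (Finset.mem_filter.mp hi).2, Finset.prod_const, count,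
    ← Set.ncard_coe_finset]
  simp

theorem integral_simpleFunc_sub_one {Λ : Measure E} [IsFiniteMeasure Λ] (g : SimpleFunc E ℝ) :
    ∫ x, (g x - 1) ∂Λ = ∑ c ∈ g.range, Λ.real (g ⁻¹' {c}) * (c - 1) := by
  have hg : Integrable g Λ := g.integrable_of_isFiniteMeasure
  rw [integral_sub hg (integrable_const 1), g.integral_eq_sum hg, integral_const, smul_eq_mul,
    mul_one]
  simp only [smul_eq_mul, mul_sub, mul_one, Finset.sum_sub_distrib]
  rw [sum_measureReal_preimage_singleton g.range fun c _ => g.measurableSet_preimage {c},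
    g.coe_range, Set.preimage_range]

variable [MeasurableSpace Ω] {μ : Measure Ω} {N : Ω → ℕ} {X : ℕ → Ω → E} {Λ : Measure E}

theorem IsPoissonProcess.aemeasurable_count (h : IsPoissonProcess μ N X Λ) {A : Set E}
    (hA : MeasurableSet A) : AEMeasurable (count N X A) μ := by
  refine aemeasurable_of_map_neZero ?_
  rw [h.map_count A hA]
  infer_instance

theorem IsPoissonProcess.iIndepFun_count (h : IsPoissonProcess μ N X Λ) {ι : Type*} [Finite ι]
    {A : ι → Set E} (hA : ∀ j, MeasurableSet (A j)) (hd : Pairwise (Function.onFun Disjoint A)) :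
    iIndepFun (fun j => count N X (A j)) μ := by
  obtain ⟨k, ⟨e⟩⟩ := Finite.exists_equiv_fin ι
  have hfin := h.indep_count k (A ∘ e.symm) (fun j => hA _)
    fun i j hij => hd (e.symm.injective.ne hij)
  simpa using hfin.precomp e.injective

theorem IsPoissonProcess.integral_pow_count (h : IsPoissonProcess μ N X Λ) {A : Set E}
    (hA : MeasurableSet A) (c : ℝ) :
    ∫ ω, c ^ count N X A ω ∂μ = Real.exp (Λ.real A * (c - 1)) := by
  rw [← integral_map (f := fun n : ℕ => c ^ n) (h.aemeasurable_count hA)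
    Measurable.of_discrete.aestronglyMeasurable, h.map_count A hA, integral_pow_poissonMeasure]
  rfl

theorem IsPoissonProcess.integral_prod_simpleFunc [IsFiniteMeasure Λ]
    (h : IsPoissonProcess μ N X Λ) (g : SimpleFunc E ℝ) :
    ∫ ω, ∏ i ∈ Finset.range (N ω), g (X i ω) ∂μ = Real.exp (∫ x, (g x - 1) ∂Λ) := by
  have hmeas (c : ℝ) : MeasurableSet (g ⁻¹' {c}) := g.measurableSet_preimage {c}
  have hind : iIndepFun (fun c : g.range => count N X (g ⁻¹' {(c : ℝ)})) μ :=
    h.iIndepFun_count (fun c => hmeas c) fun c d hcd =>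
      (Set.disjoint_singleton.mpr (Subtype.coe_ne_coe.mpr hcd)).preimage g
  calc ∫ ω, ∏ i ∈ Finset.range (N ω), g (X i ω) ∂μ
      = ∫ ω, ∏ c : g.range, (c : ℝ) ^ count N X (g ⁻¹' {(c : ℝ)}) ω ∂μ := by
        congr 1 with ω
        rw [prod_range_eq_prod_pow_count,
          Finset.prod_coe_sort g.range fun c => c ^ count N X (g ⁻¹' {c}) ω]
    _ = ∏ c : g.range, ∫ ω, (c : ℝ) ^ count N X (g ⁻¹' {(c : ℝ)}) ω ∂μ :=
        hind.integral_fun_prod_comp (f := fun (c : g.range) n => (c : ℝ) ^ n)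
          (fun c => h.aemeasurable_count (hmeas c))
          fun c => Measurable.of_discrete.aestronglyMeasurable
    _ = ∏ c : g.range, Real.exp (Λ.real (g ⁻¹' {(c : ℝ)}) * (c - 1)) :=
        Finset.prod_congr rfl fun c _ => h.integral_pow_count (hmeas c) c
    _ = Real.exp (∫ x, (g x - 1) ∂Λ) := by
        rw [← Real.exp_sum, integral_simpleFunc_sub_one,
          Finset.sum_coe_sort g.range fun c => Λ.real (g ⁻¹' {c}) * (c - 1)]

theorem measurable_prod_range {β : Type*} [CommMonoid β] [MeasurableSpace β] [MeasurableMul₂ β]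
    (hN : Measurable N) {Y : ℕ → Ω → β} (hY : ∀ i, Measurable (Y i)) :
    Measurable fun ω => ∏ i ∈ Finset.range (N ω), Y i ω := by
  have h : Measurable fun p : ℕ × Ω => ∏ i ∈ Finset.range p.1, Y i p.2 :=
    measurable_from_prod_countable_right fun n =>
      Finset.measurable_fun_prod (Finset.range n) fun i _ => hY i
  exact h.comp (hN.prodMk measurable_id)

theorem IsPoissonProcess.integral_prod [IsFiniteMeasure μ] [IsFiniteMeasure Λ]
    (h : IsPoissonProcess μ N X Λ) {g : E → ℝ} (hg : Measurable g) (hg1 : ∀ x, ‖g x‖ ≤ 1) :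
    ∫ ω, ∏ i ∈ Finset.range (N ω), g (X i ω) ∂μ = Real.exp (∫ x, (g x - 1) ∂Λ) := by
  have h0 : (0 : ℝ) ∈ Metric.closedBall (0 : ℝ) 1 := by simp
  let G : ℕ → SimpleFunc E ℝ := SimpleFunc.approxOn g hg (Metric.closedBall 0 1) 0 h0
  have hG1 (n x) : ‖G n x‖ ≤ 1 :=
    mem_closedBall_zero_iff.mp (SimpleFunc.approxOn_mem hg h0 n x)
  have hG (x) : Tendsto (fun n => G n x) atTop (𝓝 (g x)) :=
    SimpleFunc.tendsto_approxOn hg h0 (subset_closure (mem_closedBall_zero_iff.mpr (hg1 x)))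
  have hprod : Tendsto (fun n => ∫ ω, ∏ i ∈ Finset.range (N ω), G n (X i ω) ∂μ) atTop
      (𝓝 (∫ ω, ∏ i ∈ Finset.range (N ω), g (X i ω) ∂μ)) := by
    refine tendsto_integral_of_dominated_convergence (fun _ => 1)
      (fun n => (measurable_prod_range h.measurable_number
        fun i => (G n).measurable.comp (h.measurable_point i)).aestronglyMeasurable)
      (integrable_const _) (fun n => .of_forall fun ω => ?_)
      (.of_forall fun ω => tendsto_finsetProd _ fun i _ => hG _)
    rw [norm_prod]
    exact Finset.prod_le_one (fun i _ => norm_nonneg _) fun i _ => hG1 n _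
  have hexp : Tendsto (fun n => Real.exp (∫ x, (G n x - 1) ∂Λ)) atTop
      (𝓝 (Real.exp (∫ x, (g x - 1) ∂Λ))) := by
    refine (Real.continuous_exp.tendsto _).comp
      (tendsto_integral_of_dominated_convergence (fun _ => 1 + 1)
        (fun n => ((G n).measurable.sub_const 1).aestronglyMeasurable) (integrable_const _)
        (fun n => .of_forall fun x => ?_) (.of_forall fun x => (hG x).sub_const 1))
    exact norm_sub_le_of_le (hG1 n x) norm_one.le
  simp_rw [h.integral_prod_simpleFunc] at hprod
  exact tendsto_nhds_unique hprod hexp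

end PoissonProcess

section Marking

variable {Ω E : Type*} [MeasurableSpace Ω]

theorem lintegral_eq_tsum_setLIntegral_fiber {ι : Type*} [Countable ι] [MeasurableSpace ι]
    [MeasurableSingletonClass ι] (μ : Measure Ω) {J : Ω → ι} (hJ : Measurable J) (f : Ω → ℝ≥0∞) :
    ∫⁻ ω, f ω ∂μ = ∑' j, ∫⁻ ω in J ⁻¹' {j}, f ω ∂μ := by
  rw [← lintegral_iUnion (fun j => hJ (measurableSet_singleton j)) (pairwise_disjoint_fiber J),
    ← Set.preimage_iUnion, Set.iUnion_of_singleton, Set.preimage_univ, setLIntegral_univ]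

theorem setLIntegral_eq_sum_marks (μ : Measure Ω) {M : ℕ → Ω → Bool} (hM : ∀ i, Measurable (M i))
    (N : Ω → ℕ) (n : ℕ) (f : Ω → ℝ≥0∞) :
    ∫⁻ ω in {ω | N ω = n}, f ω ∂μ =
      ∑ s : Fin n → Bool, ∫⁻ ω in {ω | N ω = n ∧ ∀ i : Fin n, M i ω = s i}, f ω ∂μ := by
  have hMn : Measurable fun ω (i : Fin n) => M i ω := measurable_pi_lambda _ fun i => hM i
  rw [lintegral_eq_tsum_setLIntegral_fiber _ hMn, tsum_fintype]
  refine Finset.sum_congr rfl fun s _ => ?_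
  rw [Measure.restrict_restrict (hMn (measurableSet_singleton s))]
  congr 2
  ext ω
  simp [funext_iff, and_comm]

/-- The event that no point lying in `S` is marked `true`. -/
def voidEvent (N : Ω → ℕ) (X : ℕ → Ω → E) (M : ℕ → Ω → Bool) (S : Set E) : Set Ω :=
  {ω | ∀ i < N ω, M i ω = true → X i ω ∉ S}

/-- The conditional probability that a point at `x` gets the mark `b`. -/
noncomputable def markWeight (q : E → ℝ) (b : Bool) (x : E) : ℝ≥0∞ :=
  ENNReal.ofReal (if b = true then q x else 1 - q x)

variable [MeasurableSpace E] {μ : Measure Ω} {N : Ω → ℕ} {X : ℕ → Ω → E} {M : ℕ → Ω → Bool}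
  {q : E → ℝ} {S : Set E}

theorem measurable_markWeight (hq : Measurable q) (b : Bool) : Measurable (markWeight q b) :=
  (Measurable.ite (.const _) hq (hq.const_sub 1)).ennreal_ofReal

theorem measurableSet_voidEvent (hN : Measurable N) (hX : ∀ i, Measurable (X i))
    (hM : ∀ i, Measurable (M i)) (hS : MeasurableSet S) :
    MeasurableSet (voidEvent N X M S) := by
  unfold voidEvent
  measurability

theorem IsIndependentMarking.setLIntegral_marks_eq (h : IsIndependentMarking μ N X q M)
    (hX : ∀ i, Measurable (X i)) (hq : Measurable q) (n : ℕ)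
    (s : Fin n → Bool) {G : (Fin n → E) → ℝ≥0∞} (hG : Measurable G) :
    ∫⁻ ω in {ω | N ω = n ∧ ∀ i : Fin n, M i ω = s i}, G (fun i => X i ω) ∂μ =
      ∫⁻ ω in {ω | N ω = n}, (∏ i, markWeight q (s i) (X i ω)) * G (fun i => X i ω) ∂μ := by
  have hXn : Measurable fun ω (i : Fin n) => X i ω := measurable_pi_lambda _ fun i => hX i
  have hW : Measurable fun x : Fin n → E => ∏ i, markWeight q (s i) (x i) :=
    Finset.measurable_fun_prod _ fun i _ =>
      (measurable_markWeight hq (s i)).comp (measurable_pi_apply i)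
  have hlaw : (μ.restrict {ω | N ω = n ∧ ∀ i : Fin n, M i ω = s i}).map
      (fun ω (i : Fin n) => X i ω) =
      ((μ.restrict {ω | N ω = n}).map fun ω (i : Fin n) => X i ω).withDensity
        fun x => ∏ i, markWeight q (s i) (x i) := by
    ext B hB
    rw [Measure.map_apply hXn hB, Measure.restrict_apply (hXn hB), withDensity_apply _ hB,
      setLIntegral_map hB hW hXn, Measure.restrict_restrict (hXn hB)]
    convert h.joint_law n B s hB using 2
    · ext ω
      simp only [Set.mem_inter_iff, Set.mem_preimage, Set.mem_ofPred_eq]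
      tauto
    · rw [Set.inter_comm]
      rfl
    · rfl
  rw [← lintegral_map hG hXn, hlaw, lintegral_withDensity_eq_lintegral_mul _ hW hG,
    lintegral_map (hW.mul hG) hXn]
  rfl

/-- Summing over the `2 ^ n` mark patterns on `{N = n}` turns the sum of products into a product
of sums. -/
theorem IsIndependentMarking.lintegral_prod_marks (h : IsIndependentMarking μ N X q M)
    (hN : Measurable N) (hX : ∀ i, Measurable (X i)) (hq : Measurable q) {f : E → Bool → ℝ≥0∞}
    (hf : ∀ b, Measurable fun x => f x b) :
    ∫⁻ ω, ∏ i ∈ Finset.range (N ω), f (X i ω) (M i ω) ∂μ =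
      ∫⁻ ω, ∏ i ∈ Finset.range (N ω), ∑ b, markWeight q b (X i ω) * f (X i ω) b ∂μ := by
  classical
  rw [lintegral_eq_tsum_setLIntegral_fiber μ hN, lintegral_eq_tsum_setLIntegral_fiber μ hN]
  congr 1 with n
  have hNn : MeasurableSet {ω | N ω = n} := hN (measurableSet_singleton n)
  have hNM (s : Fin n → Bool) : MeasurableSet {ω | N ω = n ∧ ∀ i : Fin n, M i ω = s i} := by
    have hM := h.measurable_mark
    measurability
  have hWf (s : Fin n → Bool) : Measurable fun ω =>
      ∏ i : Fin n, markWeight q (s i) (X i ω) * f (X i ω) (s i) :=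
    Finset.measurable_fun_prod _ fun i _ =>
      ((measurable_markWeight hq (s i)).mul (hf (s i))).comp (hX i)
  calc ∫⁻ ω in {ω | N ω = n}, ∏ i ∈ Finset.range (N ω), f (X i ω) (M i ω) ∂μ
      = ∑ s : Fin n → Bool, ∫⁻ ω in {ω | N ω = n ∧ ∀ i : Fin n, M i ω = s i},
          ∏ i : Fin n, f (X i ω) (s i) ∂μ := by
        rw [setLIntegral_eq_sum_marks μ h.measurable_mark]
        refine Finset.sum_congr rfl fun s _ => setLIntegral_congr_fun (hNM s) ?_
        rintro ω ⟨rfl, hs⟩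
        simp_rw [Finset.prod_range, hs]
    _ = ∑ s : Fin n → Bool, ∫⁻ ω in {ω | N ω = n},
          ∏ i : Fin n, markWeight q (s i) (X i ω) * f (X i ω) (s i) ∂μ := by
        refine Finset.sum_congr rfl fun s _ => ?_
        rw [h.setLIntegral_marks_eq hX hq n s (G := fun x => ∏ i, f (x i) (s i)) <|
          Finset.measurable_fun_prod _ fun i _ => (hf (s i)).comp (measurable_pi_apply i)]
        simp_rw [Finset.prod_mul_distrib]
    _ = ∫⁻ ω in {ω | N ω = n}, ∏ i ∈ Finset.range (N ω),
          ∑ b, markWeight q b (X i ω) * f (X i ω) b ∂μ := by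
        rw [← lintegral_finsetSum _ fun s _ => hWf s]
        refine setLIntegral_congr_fun hNn ?_
        rintro ω rfl
        simp only [Finset.prod_range, Fintype.prod_sum]

theorem IsIndependentMarking.measure_voidEvent (h : IsIndependentMarking μ N X q M)
    (hN : Measurable N) (hX : ∀ i, Measurable (X i)) (hq : Measurable q)
    (hq01 : ∀ x, q x ∈ Set.Icc (0 : ℝ) 1) (hS : MeasurableSet S) :
    μ (voidEvent N X M S) =
      ∫⁻ ω, ∏ i ∈ Finset.range (N ω), ENNReal.ofReal (1 - S.indicator q (X i ω)) ∂μ := by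
  classical
  let f : E → Bool → ℝ≥0∞ := fun x b => if b = true → x ∉ S then 1 else 0
  have hf (b : Bool) : Measurable fun x => f x b :=
    Measurable.ite ((MeasurableSet.const _).imp hS.compl) measurable_const measurable_const
  have hsum (x : E) :
      ∑ b, markWeight q b x * f x b = ENNReal.ofReal (1 - S.indicator q x) := by
    by_cases hx : x ∈ S
    · simp [f, markWeight, hx]
    · simp [f, markWeight, hx, ← ENNReal.ofReal_add (hq01 x).1 (sub_nonneg.mpr (hq01 x).2)]
  have hprod (ω : Ω) : ∏ i ∈ Finset.range (N ω), f (X i ω) (M i ω) =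
      (voidEvent N X M S).indicator 1 ω := by
    simp [f, Set.indicator_apply, voidEvent, Finset.prod_ite_zero]
  rw [← lintegral_indicator_one (measurableSet_voidEvent hN hX h.measurable_mark hS)]
  simp_rw [← hprod, h.lintegral_prod_marks hN hX hq hf, hsum]

theorem IsPoissonProcess.measure_voidEvent [IsFiniteMeasure μ] {Λ : Measure E} [IsFiniteMeasure Λ]
    (h : IsPoissonProcess μ N X Λ) (hM : IsIndependentMarking μ N X q M) (hq : Measurable q)
    (hq01 : ∀ x, q x ∈ Set.Icc (0 : ℝ) 1) (hS : MeasurableSet S) :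
    μ (voidEvent N X M S) = ENNReal.ofReal (Real.exp (-∫ x in S, q x ∂Λ)) := by
  let g : E → ℝ := fun x => 1 - S.indicator q x
  have hg : Measurable g := (hq.indicator hS).const_sub 1
  have hg01 (x) : g x ∈ Set.Icc (0 : ℝ) 1 := by
    have hS01 : S.indicator q x ∈ Set.Icc (0 : ℝ) 1 := by
      by_cases hx : x ∈ S <;> simp [hx, (hq01 x).1, (hq01 x).2]
    exact Set.Icc.mem_iff_one_sub_mem.mp hS01
  have hg1 (x) : ‖g x‖ ≤ 1 := by
    rw [Real.norm_of_nonneg (hg01 x).1]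
    exact (hg01 x).2
  have hint : Integrable (fun ω => ∏ i ∈ Finset.range (N ω), g (X i ω)) μ := by
    refine Integrable.of_bound (C := 1) (measurable_prod_range h.measurable_number
      fun i => hg.comp (h.measurable_point i)).aestronglyMeasurable (.of_forall fun ω => ?_)
    rw [norm_prod]
    exact Finset.prod_le_one (fun i _ => norm_nonneg _) fun i _ => hg1 _
  calc μ (voidEvent N X M S)
      = ∫⁻ ω, ENNReal.ofReal (∏ i ∈ Finset.range (N ω), g (X i ω)) ∂μ := by
        simp_rw [hM.measure_voidEvent h.measurable_number h.measurable_point hq hq01 hS,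
          ENNReal.ofReal_prod_of_nonneg fun _ _ => (hg01 _).1, g]
    _ = ENNReal.ofReal (Real.exp (∫ x, (g x - 1) ∂Λ)) := by
        rw [← ofReal_integral_eq_lintegral_ofReal hint
          (.of_forall fun ω => Finset.prod_nonneg fun i _ => (hg01 _).1), h.integral_prod hg hg1]
    _ = ENNReal.ofReal (Real.exp (-∫ x in S, q x ∂Λ)) := by
        rw [← integral_indicator hS, ← integral_neg]
        simp [g]

end Marking

section TwoCircles

variable {R l r : ℝ}

theorem sq_delta (h1 : |R - r| ≤ l) (h2 : l ≤ R + r) :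
    16 * delta R l r ^ 2 = (r + R + l) * (r + R - l) * (r - R + l) * (-r + R + l) := by
  obtain ⟨h3, h4⟩ := abs_le.mp h1
  have heron : 0 ≤ (r + R + l) * (r + R - l) * (r - R + l) * (-r + R + l) :=
    mul_nonneg (mul_nonneg (mul_nonneg (by linarith) (by linarith)) (by linarith)) (by linarith)
  rw [delta, div_pow, Real.sq_sqrt heron]
  ring

theorem x₁_pos (h1 : |R - r| < l) (h2 : l < R + r) : 0 < x₁ R l r := by
  obtain ⟨h3, h4⟩ := abs_lt.mp h1
  have heron : 0 < (r + R + l) * (r + R - l) * (r - R + l) * (-r + R + l) :=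
    mul_pos (mul_pos (mul_pos (by linarith) (by linarith)) (by linarith)) (by linarith)
  have hr : 0 < r := by linarith
  unfold x₁ delta
  positivity

theorem y₁₂_sub (hr : r ≠ 0) : y₁₂ R l r - r = (R ^ 2 - r ^ 2 - l ^ 2) / (2 * r) := by
  rw [y₁₂]
  field_simp
  ring

theorem sq_x₁_add_sq_y₁₂_sub (hr : r ≠ 0) (h1 : |R - r| ≤ l) (h2 : l ≤ R + r) :
    x₁ R l r ^ 2 + (y₁₂ R l r - r) ^ 2 = l ^ 2 := by
  rw [y₁₂_sub hr, x₁]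
  field_simp
  linear_combination sq_delta h1 h2

theorem mem_sphere_iff_sq_add_sq (hl : 0 ≤ l) (p c : Plane) :
    p ∈ Metric.sphere c l ↔ (p 0 - c 0) ^ 2 + (p 1 - c 1) ^ 2 = l ^ 2 := by
  rw [mem_sphere_iff_norm, ← sq_eq_sq₀ (norm_nonneg _) hl, EuclideanSpace.real_norm_sq_eq]
  simp [Fin.sum_univ_two]

theorem eq_vec_iff (p : Plane) (a b : ℝ) : p = !₂[a, b] ↔ p 0 = a ∧ p 1 = b := by
  simp [PiLp.ext_iff, Fin.forall_fin_two]

theorem sphere_inter_sphere (h1 : |R - r| < l) (h2 : l < R + r) :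
    Metric.sphere (0 : Plane) R ∩ Metric.sphere (!₂[0, r] : Plane) l =
      {!₂[x₁ R l r, y₁₂ R l r], !₂[x₂ R l r, y₁₂ R l r]} := by
  obtain ⟨h3, h4⟩ := abs_lt.mp h1
  have hr : 0 < r := by linarith
  have hy : 2 * r * (y₁₂ R l r - r) = R ^ 2 - r ^ 2 - l ^ 2 := by
    rw [y₁₂_sub hr.ne']
    field_simp
  have hx := sq_x₁_add_sq_y₁₂_sub hr.ne' h1.le h2.le
  have hx₂ : x₂ R l r = -x₁ R l r := rfl
  ext p
  simp only [Set.mem_inter_iff, mem_sphere_iff_sq_add_sq (by linarith : 0 ≤ R),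
    mem_sphere_iff_sq_add_sq (by linarith : 0 ≤ l), Set.mem_insert_iff, Set.mem_singleton_iff,
    eq_vec_iff, hx₂, ← or_and_right, ← sq_eq_sq_iff_eq_or_eq_neg]
  simp only [PiLp.zero_apply, sub_zero, Matrix.cons_val_zero, Matrix.cons_val_one]
  constructor
  · rintro ⟨hR, hl⟩
    have hp : p 1 = y₁₂ R l r :=
      mul_left_cancel₀ (mul_pos two_pos hr).ne' (by linear_combination hR - hl - hy)
    refine ⟨?_, hp⟩
    rw [hp] at hl
    linear_combination hl - hx
  · rintro ⟨hp0, hp1⟩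
    rw [hp0, hp1]
    constructor
    · linear_combination hx + hy
    · exact hx

theorem m₂_eq_neg (R l r : ℝ) : m₂ R l r = -m₁ R l r := by
  rw [m₂, m₁, x₂, x₁, div_neg]

theorem theta_eq (h : l < R + r) : theta R l r = Real.pi + 2 * Real.arctan (m₁ R l r) := by
  rw [theta, if_pos h, m₂_eq_neg, Real.arctan_neg]
  ring

theorem theta_mem_Ioo (h : l < R + r) : theta R l r ∈ Set.Ioo 0 (2 * Real.pi) := by
  rw [theta_eq h]
  constructor <;>
    linarith [Real.neg_pi_div_two_lt_arctan (m₁ R l r), Real.arctan_lt_pi_div_two (m₁ R l r)]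

theorem tan_theta (h : l < R + r) :
    Real.tan (theta R l r) = (m₁ R l r - m₂ R l r) / (1 + m₁ R l r * m₂ R l r) := by
  rw [theta_eq h, add_comm, Real.tan_add_pi, Real.tan_two_mul, Real.tan_arctan, m₂_eq_neg]
  ring_nf

theorem arctan_div_eq_arcsin_div {x y : ℝ} (hx : 0 < x) (hl : 0 ≤ l) (h : x ^ 2 + y ^ 2 = l ^ 2) :
    Real.arctan (y / x) = Real.arcsin (y / l) := by
  have hsq : 1 + (y / x) ^ 2 = (l / x) ^ 2 := by
    field_simp
    exact h
  rw [Real.arctan_eq_arcsin, hsq, Real.sqrt_sq (div_nonneg hl hx.le),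
    div_div_div_cancel_right₀ hx.ne']

/-- The cosine of the angle at the user between the outward direction and an intersection point of
the two circles, by the law of cosines. For `l, r > 0` it lies outside `[-1, 1]` exactly when the
circles do not meet. -/
noncomputable def cosAngle (R l r : ℝ) : ℝ := (R ^ 2 - r ^ 2 - l ^ 2) / (2 * l * r)

theorem theta_eq_arccos (hr : 0 < r) (h : |R - r| < l) :
    theta R l r = 2 * Real.pi - 2 * Real.arccos (cosAngle R l r) := by
  obtain ⟨h3, h4⟩ := abs_lt.mp h
  have hl : 0 < l := by linarith
  rcases lt_or_ge l (R + r) with h2 | h2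
  · have hcos : (y₁₂ R l r - r) / l = cosAngle R l r := by
      rw [y₁₂_sub hr.ne', cosAngle, div_div]
      ring_nf
    rw [theta_eq h2, m₁, arctan_div_eq_arcsin_div (x₁_pos h h2) hl.le
      (sq_x₁_add_sq_y₁₂_sub hr.ne' h.le h2.le), hcos, Real.arccos]
    ring
  · have hcos : cosAngle R l r ≤ -1 := by
      rw [cosAngle, div_le_iff₀ (by positivity)]
      nlinarith
    rw [theta, if_neg h2.not_gt, Real.arccos_of_le_neg_one hcos, sub_self]

end TwoCircles

section ArcLength

theorem cos_le_iff_arccos_le_abs {c φ : ℝ} (hφ : |φ| < Real.pi) :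
    Real.cos φ ≤ c ↔ Real.arccos c ≤ |φ| := by
  have hmem : Real.pi / 2 - |φ| ∈ Set.Ioc (-(Real.pi / 2)) (Real.pi / 2) :=
    ⟨by linarith, by linarith [abs_nonneg φ]⟩
  rw [← Real.cos_abs, ← Real.sin_pi_div_two_sub, ← Real.le_arcsin_iff_sin_le' hmem, Real.arccos]
  constructor <;> intro h <;> linarith

theorem volume_real_setOf_cos_le (c : ℝ) :
    volume.real ({φ | Real.cos φ ≤ c} ∩ Set.Ioc (-Real.pi) Real.pi) =
      2 * Real.pi - 2 * Real.arccos c := by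
  have hpi := Real.pi_pos
  have hset : {φ | Real.cos φ ≤ c} ∩ Set.Ioo (-Real.pi) Real.pi =
      Set.Ioo (-Real.pi) Real.pi \ Set.Ioo (-Real.arccos c) (Real.arccos c) := by
    ext φ
    rw [Set.inter_comm]
    refine and_congr_right fun hφ => ?_
    rw [Set.mem_ofPred_eq, cos_le_iff_arccos_le_abs (abs_lt.mpr hφ), Set.mem_Ioo, ← abs_lt, not_lt]
  have hae : ({φ | Real.cos φ ≤ c} ∩ Set.Ioc (-Real.pi) Real.pi : Set ℝ) =ᵐ[volume]
      ({φ | Real.cos φ ≤ c} ∩ Set.Ioo (-Real.pi) Real.pi : Set ℝ) :=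
    (ae_eq_refl _).inter Ioo_ae_eq_Ioc.symm
  have hsub : Set.Ioo (-Real.arccos c) (Real.arccos c) ⊆ Set.Ioo (-Real.pi) Real.pi :=
    Set.Ioo_subset_Ioo (neg_le_neg (Real.arccos_le_pi c)) (Real.arccos_le_pi c)
  rw [measureReal_congr hae, hset, measureReal_sdiff hsub measurableSet_Ioo (by simp),
    Real.volume_real_Ioo_of_le (by linarith),
    Real.volume_real_Ioo_of_le (by linarith [Real.arccos_nonneg c])]
  ring

theorem volume_preimage_sub_inter_Ioc {T : ℝ} (hT : 0 < T) {A : Set ℝ} (hA : MeasurableSet A)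
    (hper : Function.Periodic (· ∈ A) T) (a α : ℝ) :
    volume ((fun x => x - α) ⁻¹' A ∩ Set.Ioc a (a + T)) = volume (A ∩ Set.Ioc a (a + T)) := by
  have hinv (g : AddSubgroup.zmultiples T) : (g +ᵥ ·) ⁻¹' A = A := by
    obtain ⟨_, n, rfl⟩ := g
    ext x
    rw [Set.mem_preimage, AddSubgroup.vadd_def, vadd_eq_add, add_comm]
    exact (hper.zsmul n x).to_iff
  have hshift : (fun x => x - α) ⁻¹' (A ∩ Set.Ioc (a - α) (a - α + T)) =
      (fun x => x - α) ⁻¹' A ∩ Set.Ioc a (a + T) := by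
    rw [Set.preimage_inter, Set.preimage_sub_const_Ioc]
    ring_nf
  rw [← hshift, (measurePreserving_sub_right volume α).measure_preimage
    (hA.inter measurableSet_Ioc).nullMeasurableSet]
  exact (isAddFundamentalDomain_Ioc hT _).measure_set_eq (isAddFundamentalDomain_Ioc hT _) hA hinv

theorem exists_eq_polar (u : Plane) :
    ∃ α : ℝ, u 0 = ‖u‖ * Real.cos α ∧ u 1 = ‖u‖ * Real.sin α := by
  have hn : ‖(⟨u 0, u 1⟩ : ℂ)‖ = ‖u‖ := by
    rw [Complex.norm_eq_sqrt_sq_add_sq, EuclideanSpace.norm_eq]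
    simp [Fin.sum_univ_two]
  refine ⟨Complex.arg ⟨u 0, u 1⟩, ?_, ?_⟩
  · rw [← hn, Complex.norm_mul_cos_arg]
  · rw [← hn, Complex.norm_mul_sin_arg]

/-- The point at angle `φ` on the circle of centre `u` and radius `l`. -/
noncomputable def circlePoint (u : Plane) (l φ : ℝ) : Plane := u + l • !₂[Real.cos φ, Real.sin φ]

/-- The angles, normalized to `(-π, π]`, at which the circle of centre `u` and radius `l` lies in
`A`. -/
def circleAngles (A : Set Plane) (u : Plane) (l : ℝ) : Set ℝ :=
  {φ | φ ∈ Set.Ioc (-Real.pi) Real.pi ∧ circlePoint u l φ ∈ A}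

theorem arcLengthInDisk_eq_mul_volume (R : ℝ) (u : Plane) (l : ℝ) :
    arcLengthInDisk R u l = l * volume.real (circleAngles (Metric.closedBall 0 R) u l) :=
  rfl

theorem continuous_circlePoint (u : Plane) :
    Continuous fun p : ℝ × ℝ => circlePoint u p.1 p.2 := by
  unfold circlePoint
  fun_prop

theorem dist_circlePoint (u : Plane) (l φ : ℝ) : dist u (circlePoint u l φ) = |l| := by
  rw [dist_eq_norm', circlePoint, add_sub_cancel_left, norm_smul, EuclideanSpace.norm_eq]
  simp [Fin.sum_univ_two]

theorem sq_norm_circlePoint (u : Plane) (l φ : ℝ) :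
    ‖circlePoint u l φ‖ ^ 2 =
      ‖u‖ ^ 2 + l ^ 2 + 2 * l * (u 0 * Real.cos φ + u 1 * Real.sin φ) := by
  rw [EuclideanSpace.real_norm_sq_eq, EuclideanSpace.real_norm_sq_eq]
  simp only [circlePoint, Fin.sum_univ_two, PiLp.add_apply, PiLp.smul_apply, smul_eq_mul,
    Matrix.cons_val_zero, Matrix.cons_val_one]
  linear_combination l ^ 2 * Real.sin_sq_add_cos_sq φ

theorem volume_circleAngles_le (A : Set Plane) (u : Plane) (l : ℝ) :
    volume (circleAngles A u l) ≤ ENNReal.ofReal (2 * Real.pi) := by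
  refine (measure_mono fun φ hφ => hφ.1).trans_eq (?_ : volume (Set.Ioc (-Real.pi) Real.pi) = _)
  rw [Real.volume_Ioc]
  ring_nf

theorem arcLengthInDisk_nonneg (R : ℝ) (u : Plane) {l : ℝ} (hl : 0 ≤ l) :
    0 ≤ arcLengthInDisk R u l :=
  mul_nonneg hl measureReal_nonneg

theorem arcLengthInDisk_le (R : ℝ) (u : Plane) {l : ℝ} (hl : 0 ≤ l) :
    arcLengthInDisk R u l ≤ 2 * Real.pi * l := by
  rw [arcLengthInDisk_eq_mul_volume, mul_comm]
  exact mul_le_mul_of_nonneg_right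
    (ENNReal.toReal_le_of_le_ofReal Real.two_pi_pos.le (volume_circleAngles_le _ u l)) hl

theorem measurable_volume_circleAngles {A : Set Plane} (hA : MeasurableSet A) (u : Plane) :
    Measurable fun l => volume (circleAngles A u l) :=
  measurable_measure_prodMk_left
    ((measurable_snd measurableSet_Ioc).inter ((continuous_circlePoint u).measurable hA))

theorem measurable_arcLengthInDisk (R : ℝ) (u : Plane) : Measurable (arcLengthInDisk R u) :=
  measurable_id.mul
    (measurable_volume_circleAngles Metric.isClosed_closedBall.measurableSet u).ennreal_toReal

variable {R l : ℝ} {u : Plane}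

theorem arcLengthInDisk_of_le (hl : 0 ≤ l) (h : l ≤ R - ‖u‖) :
    arcLengthInDisk R u l = 2 * Real.pi * l := by
  have hall : circleAngles (Metric.closedBall 0 R) u l = Set.Ioc (-Real.pi) Real.pi := by
    refine Set.sep_eq_self_iff_mem_true.mpr fun φ _ => ?_
    have hdist := dist_triangle 0 u (circlePoint u l φ)
    rw [dist_circlePoint, abs_of_nonneg hl, dist_zero_left u] at hdist
    rw [Metric.mem_closedBall']
    linarith
  rw [arcLengthInDisk_eq_mul_volume, hall, Real.volume_real_Ioc_of_le (by linarith [Real.pi_pos])]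
  ring

theorem circlePoint_mem_closedBall_iff {α : ℝ} (hR : 0 ≤ R) (hl : 0 < l) (hu : 0 < ‖u‖)
    (h0 : u 0 = ‖u‖ * Real.cos α) (h1 : u 1 = ‖u‖ * Real.sin α) (φ : ℝ) :
    circlePoint u l φ ∈ Metric.closedBall 0 R ↔ Real.cos (φ - α) ≤ cosAngle R l ‖u‖ := by
  rw [mem_closedBall_zero_iff, ← sq_le_sq₀ (norm_nonneg _) hR, sq_norm_circlePoint, cosAngle,
    le_div_iff₀ (by positivity), Real.cos_sub, h0, h1]
  constructor <;> intro h <;> linarith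

theorem arcLengthInDisk_of_pos (hR : 0 ≤ R) (hl : 0 < l) (hu : 0 < ‖u‖) :
    arcLengthInDisk R u l = l * (2 * Real.pi - 2 * Real.arccos (cosAngle R l ‖u‖)) := by
  obtain ⟨α, h0, h1⟩ := exists_eq_polar u
  have hangles : circleAngles (Metric.closedBall 0 R) u l =
      (fun φ => φ - α) ⁻¹' {φ | Real.cos φ ≤ cosAngle R l ‖u‖} ∩
        Set.Ioc (-Real.pi) (-Real.pi + 2 * Real.pi) := by
    ext φ
    rw [Set.inter_comm, neg_add_eq_sub, two_mul, add_sub_cancel_right]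
    exact and_congr_right fun _ => circlePoint_mem_closedBall_iff hR hl hu h0 h1 φ
  rw [arcLengthInDisk_eq_mul_volume, ← volume_real_setOf_cos_le, hangles, measureReal_def,
    volume_preimage_sub_inter_Ioc Real.two_pi_pos (measurableSet_le (by fun_prop) measurable_const)
      fun x => by simp only [Set.mem_ofPred_eq, Real.cos_add_two_pi],
    neg_add_eq_sub, two_mul, add_sub_cancel_right, measureReal_def]

theorem arcLengthInDisk_zero_of_lt (hR : 0 ≤ R) (h : R < l) : arcLengthInDisk R 0 l = 0 := by
  have hempty : circleAngles (Metric.closedBall 0 R) 0 l = ∅ := by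
    refine Set.eq_empty_of_forall_notMem fun φ hφ => ?_
    have hmem := hφ.2
    rw [Metric.mem_closedBall', dist_circlePoint, abs_of_pos (hR.trans_lt h)] at hmem
    exact hmem.not_gt h
  rw [arcLengthInDisk_eq_mul_volume, hempty, measureReal_empty, mul_zero]

theorem arcLengthInDisk_eq_C (hR : 0 ≤ R) (h : |R - ‖u‖| < l) :
    arcLengthInDisk R u l = C R l ‖u‖ := by
  rcases eq_or_ne u 0 with rfl | hu
  · rw [norm_zero, sub_zero, abs_of_nonneg hR] at h
    rw [arcLengthInDisk_zero_of_lt hR h, C, theta, norm_zero, add_zero, if_neg h.not_gt, zero_mul]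
  · rw [arcLengthInDisk_of_pos hR ((abs_nonneg _).trans_lt h) (norm_pos_iff.mpr hu), C,
      theta_eq_arccos (norm_pos_iff.mpr hu) h, mul_comm]

end ArcLength

section PolarCoordinates

theorem measurePreserving_vec :
    MeasurePreserving fun p : ℝ × ℝ => (!₂[p.1, p.2] : Plane) :=
  (PiLp.volume_preserving_toLp (Fin 2)).comp (volume_preserving_finTwoArrow ℝ).symm

theorem add_vec_polarCoord_symm (u : Plane) (p : ℝ × ℝ) :
    u + !₂[(polarCoord.symm p).1, (polarCoord.symm p).2] = circlePoint u p.1 p.2 := by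
  simp [circlePoint, PiLp.ext_iff, Fin.forall_fin_two, polarCoord_symm_apply]

theorem lintegral_plane_polar (u : Plane) {f : Plane → ℝ≥0∞} (hf : Measurable f) :
    ∫⁻ x, f x = ∫⁻ v in Set.Ioi (0 : ℝ), ENNReal.ofReal v *
      ∫⁻ φ in Set.Ioc (-Real.pi) Real.pi, f (circlePoint u v φ) := by
  have hfu : Measurable fun x => f (u + x) := hf.comp (measurable_const_add u)
  have hcircle : Measurable fun p : ℝ × ℝ => f (circlePoint u p.1 p.2) :=
    hf.comp (continuous_circlePoint u).measurable
  have hangle (v : ℝ) : Measurable fun φ => f (circlePoint u v φ) :=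
    hcircle.comp measurable_prodMk_left
  have hjoint : Measurable fun p : ℝ × ℝ => ENNReal.ofReal p.1 * f (circlePoint u p.1 p.2) :=
    measurable_fst.ennreal_ofReal.mul hcircle
  calc ∫⁻ x, f x
      = ∫⁻ p : ℝ × ℝ, f (u + !₂[p.1, p.2]) := by
        rw [← lintegral_add_left_eq_self f u, ← measurePreserving_vec.lintegral_comp hfu]
    _ = ∫⁻ p in Set.Ioi 0 ×ˢ Set.Ioo (-Real.pi) Real.pi,
          ENNReal.ofReal p.1 * f (circlePoint u p.1 p.2) := by
        rw [← lintegral_comp_polarCoord_symm, polarCoord_target]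
        simp_rw [add_vec_polarCoord_symm, smul_eq_mul]
    _ = ∫⁻ v in Set.Ioi 0, ∫⁻ φ in Set.Ioo (-Real.pi) Real.pi,
          ENNReal.ofReal v * f (circlePoint u v φ) := by
        rw [Measure.volume_eq_prod, ← Measure.prod_restrict, lintegral_prod _ hjoint.aemeasurable]
    _ = _ := by
        simp_rw [lintegral_const_mul _ (hangle _), restrict_Ioo_eq_restrict_Ioc]

theorem volume_eq_lintegral_volume_circleAngles (u : Plane) {A : Set Plane}
    (hA : MeasurableSet A) :
    volume A = ∫⁻ v in Set.Ioi (0 : ℝ), ENNReal.ofReal v * volume (circleAngles A u v) := by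
  rw [← lintegral_indicator_one hA, lintegral_plane_polar u (measurable_one.indicator hA)]
  congr 1 with v
  have hangles : MeasurableSet (circlePoint u v ⁻¹' A) :=
    ((continuous_circlePoint u).comp (Continuous.prodMk_right v)).measurable hA
  congr 1
  calc ∫⁻ φ in Set.Ioc (-Real.pi) Real.pi, A.indicator 1 (circlePoint u v φ)
      = ∫⁻ φ in Set.Ioc (-Real.pi) Real.pi, (circlePoint u v ⁻¹' A).indicator 1 φ := rfl
    _ = volume (circleAngles A u v) := by
        rw [lintegral_indicator_one hangles, Measure.restrict_apply hangles, Set.inter_comm]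
        rfl

theorem map_dist_restrict (u : Plane) {A : Set Plane} (hA : MeasurableSet A) :
    (volume.restrict A).map (dist u) = (volume.restrict (Set.Ioi 0)).withDensity
      fun v => ENNReal.ofReal v * volume (circleAngles A u v) := by
  have hdist : Measurable (dist u) := by fun_prop
  ext B hB
  rw [Measure.map_apply hdist hB, Measure.restrict_apply (hdist hB), withDensity_apply _ hB,
    ← lintegral_indicator hB, volume_eq_lintegral_volume_circleAngles u ((hdist hB).inter hA)]
  refine setLIntegral_congr_fun measurableSet_Ioi fun v (hv : 0 < v) => ?_
  by_cases hvB : v ∈ B <;>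
    simp [circleAngles, dist_circlePoint, abs_of_pos hv, hvB]

theorem setIntegral_closedBall_comp_dist (R : ℝ) (u : Plane) {t : ℝ} (ht : 0 ≤ t) {f : ℝ → ℝ}
    (hf : Measurable f) :
    ∫ x in Metric.closedBall u t, f (dist u x) ∂volume.restrict (Metric.closedBall 0 R) =
      ∫ v in (0 : ℝ)..t, arcLengthInDisk R u v * f v := by
  have hdist : Measurable (dist u) := by fun_prop
  have hball : Metric.closedBall u t = dist u ⁻¹' Set.Iic t := by
    ext x
    rw [Metric.mem_closedBall', Set.mem_preimage, Set.mem_Iic]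
  have hdisk : MeasurableSet (Metric.closedBall (0 : Plane) R) :=
    Metric.isClosed_closedBall.measurableSet
  have hfin (v : ℝ) : ENNReal.ofReal v * volume (circleAngles (Metric.closedBall 0 R) u v) < ∞ :=
    ENNReal.mul_lt_top ENNReal.ofReal_lt_top
      ((volume_circleAngles_le _ u v).trans_lt ENNReal.ofReal_lt_top)
  have hdens : Measurable fun v : ℝ =>
      ENNReal.ofReal v * volume (circleAngles (Metric.closedBall 0 R) u v) :=
    ENNReal.measurable_ofReal.mul (measurable_volume_circleAngles hdisk u)
  rw [hball, ← setIntegral_map measurableSet_Iic hf.aestronglyMeasurable hdist.aemeasurable,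
    map_dist_restrict u hdisk, setIntegral_withDensity_eq_setIntegral_toReal_smul hdens
      (.of_forall hfin) f measurableSet_Iic, Measure.restrict_restrict measurableSet_Iic,
    Set.Iic_inter_Ioi, intervalIntegral.integral_of_le ht]
  refine setIntegral_congr_fun measurableSet_Ioc fun v hv => ?_
  simp only [ENNReal.toReal_mul, ENNReal.toReal_ofReal hv.1.le, smul_eq_mul]
  rfl

end PolarCoordinates

section HazardRate

theorem absolutelyContinuousOnInterval_comp_of_lipschitzOnWith {f g : ℝ → ℝ} {a b : ℝ} {K : NNReal}
    (hg : LipschitzOnWith K g (f '' Set.uIcc a b)) (hf : AbsolutelyContinuousOnInterval f a b) :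
    AbsolutelyContinuousOnInterval (g ∘ f) a b := by
  rw [absolutelyContinuousOnInterval_iff] at hf ⊢
  intro ε hε
  have hK : (0 : ℝ) < K + 1 := by positivity
  obtain ⟨δ, hδ, hfδ⟩ := hf (ε / (K + 1)) (by positivity)
  refine ⟨δ, hδ, fun I hI hIδ => ?_⟩
  calc _ ≤ ∑ i ∈ Finset.range I.1, (K + 1) * dist (f (I.2 i).1) (f (I.2 i).2) := by
        refine Finset.sum_le_sum fun i hi => ?_
        refine (hg.dist_le_mul _ ⟨_, (hI.1 i hi).1, rfl⟩ _ ⟨_, (hI.1 i hi).2, rfl⟩).trans ?_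
        gcongr
        simp
    _ = (K + 1) * ∑ i ∈ Finset.range I.1, dist (f (I.2 i).1) (f (I.2 i).2) := by
        rw [Finset.mul_sum]
    _ < ε := by
        rw [← lt_div_iff₀' hK]
        exact hfδ I hI hIδ

theorem absolutelyContinuousOnInterval_comp_of_contDiff {f g : ℝ → ℝ} {a b : ℝ}
    (hg : ContDiff ℝ 1 g) (hf : AbsolutelyContinuousOnInterval f a b) :
    AbsolutelyContinuousOnInterval (g ∘ f) a b := by
  obtain ⟨K, hK⟩ := hg.locallyLipschitz.locallyLipschitzOn.exists_lipschitzOnWith_of_compact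
    (isCompact_uIcc.image_of_continuousOn hf.continuousOn)
  exact absolutelyContinuousOnInterval_comp_of_lipschitzOnWith hK hf

variable {k : ℝ → ℝ} {a b : ℝ}

theorem integral_mul_exp_neg_integral (hk : IntervalIntegrable k volume a b) :
    ∫ v in a..b, k v * Real.exp (-∫ w in a..v, k w) = 1 - Real.exp (-∫ w in a..b, k w) := by
  have hac := absolutelyContinuousOnInterval_comp_of_contDiff
    (g := fun x => -Real.exp (-x)) (by fun_prop)
    (hk.absolutelyContinuousOnInterval_intervalIntegral (c := a) (by simp))
  have hderiv : ∫ v in a..b, deriv (fun v => -Real.exp (-∫ w in a..v, k w)) v =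
      ∫ v in a..b, k v * Real.exp (-∫ w in a..v, k w) := by
    refine intervalIntegral.integral_congr_ae ?_
    filter_upwards [hk.ae_hasDerivAt_integral] with v hv hvab
    rw [(hv (Set.uIoc_subset_uIcc hvab) a (by simp)).fun_neg.exp.fun_neg.deriv]
    ring
  rw [← hderiv]
  refine hac.integral_deriv_eq_sub.trans ?_
  simp only [Function.comp_apply, intervalIntegral.integral_same, neg_zero, Real.exp_zero]
  ring

theorem setLIntegral_hazard_density (hab : a ≤ b) (hk : IntervalIntegrable k volume a b)
    (hk0 : ∀ v ∈ Set.Icc a b, 0 ≤ k v) {B : ℝ} (hB : 0 < B) :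
    ∫⁻ l in Set.Icc a b, ENNReal.ofReal (k l * Real.exp (-∫ v in a..l, k v) / B) =
      ENNReal.ofReal ((1 - Real.exp (-∫ v in a..b, k v)) / B) := by
  have hcont : ContinuousOn (fun l => Real.exp (-∫ v in a..l, k v)) (Set.uIcc a b) :=
    (hk.absolutelyContinuousOnInterval_intervalIntegral (c := a) (by simp)).continuousOn.neg.rexp
  have hint := (hk.mul_continuousOn hcont).div_const B
  rw [← restrict_Ioc_eq_restrict_Icc, ← integral_mul_exp_neg_integral hk,
    ← intervalIntegral.integral_div, intervalIntegral.integral_of_le hab,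
    ofReal_integral_eq_lintegral_ofReal hint.1]
  refine ae_restrict_of_forall_mem measurableSet_Ioc fun l hl => ?_
  exact div_nonneg (mul_nonneg (hk0 l (Set.Ioc_subset_Icc_self hl)) (Real.exp_pos _).le) hB.le

theorem eq_withDensity_of_measure_Iic {ν : Measure ℝ} [IsFiniteMeasure ν] {g : ℝ → ℝ≥0∞}
    (hab : a ≤ b) (hν : ∀ᵐ x ∂ν, x ∈ Set.Icc a b)
    (h : ∀ t ∈ Set.Icc a b, ν (Set.Iic t) = ∫⁻ x in Set.Icc a t, g x) :
    ν = (volume.restrict (Set.Icc a b)).withDensity g := by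
  refine Measure.ext_of_Iic _ _ fun t => ?_
  rw [withDensity_apply _ measurableSet_Iic, Measure.restrict_restrict measurableSet_Iic]
  rcases lt_or_ge t a with hta | hat
  · have hν0 : ν (Set.Iic t) = 0 := by
      refine measure_mono_null (fun x hx => ?_) hν
      exact fun hxab => (hxab.1.trans hx).not_gt hta
    have hdisj : Set.Iic t ∩ Set.Icc a b = ∅ :=
      Set.disjoint_iff_inter_eq_empty.mp
        (Set.disjoint_left.mpr fun x hx hxab => (hxab.1.trans hx).not_gt hta)
    rw [hν0, hdisj, Measure.restrict_empty, lintegral_zero_measure]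
  · have hinter : Set.Iic t ∩ Set.Icc a b = Set.Icc a (min t b) := by
      ext x
      simp only [Set.mem_inter_iff, Set.mem_Iic, Set.mem_Icc, le_min_iff]
      tauto
    have hmin : ν (Set.Iic t) = ν (Set.Iic (min t b)) := by
      refine measure_congr (Filter.eventuallyEq_set.mpr ?_)
      filter_upwards [hν] with x hx
      simp [hx.2]
    rw [hinter, hmin, h _ ⟨le_min hat hab, min_le_right t b⟩]

theorem map_cond_eq_withDensity_of_hazard {Ω : Type*} [MeasurableSpace Ω] {μ : Measure Ω}
    [IsFiniteMeasure μ] {T : Ω → ℝ} {E : Set Ω} (hT : Measurable T) (hE : MeasurableSet E)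
    (hTE : ∀ ω ∈ E, T ω ∈ Set.Icc a b) (hab : a ≤ b) (hk : IntervalIntegrable k volume a b)
    (hk0 : ∀ v ∈ Set.Icc a b, 0 ≤ k v)
    (hcdf : ∀ t ∈ Set.Icc a b, μ (E ∩ T ⁻¹' Set.Iic t) =
      ENNReal.ofReal (1 - Real.exp (-∫ v in a..t, k v))) :
    (μ[|E]).map T = (volume.restrict (Set.Icc a b)).withDensity fun l =>
      ENNReal.ofReal (k l * Real.exp (-∫ v in a..l, k v) /
        (1 - Real.exp (-∫ v in a..b, k v))) := by
  have hint0 : 0 ≤ ∫ v in a..b, k v := intervalIntegral.integral_nonneg hab hk0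
  have hμE : μ E = ENNReal.ofReal (1 - Real.exp (-∫ v in a..b, k v)) := by
    rw [← hcdf b ⟨hab, le_rfl⟩,
      Set.inter_eq_left.mpr (show E ⊆ T ⁻¹' Set.Iic b from fun ω hω => (hTE ω hω).2)]
  rcases hint0.eq_or_lt with hint | hint
  -- If `E` is null, both sides vanish: the density because `x / 0 = 0`.
  · have hμE0 : μ E = 0 := by simp [hμE, ← hint]
    simp [cond_eq_zero_of_meas_eq_zero hμE0, ← hint]
  · have hB : 0 < 1 - Real.exp (-∫ v in a..b, k v) := by
      rw [sub_pos, Real.exp_lt_one_iff]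
      exact neg_lt_zero.mpr hint
    refine eq_withDensity_of_measure_Iic hab ?_ fun t ht => ?_
    · refine (ae_map_iff hT.aemeasurable measurableSet_Icc).mpr ?_
      filter_upwards [ae_cond_mem hE] using hTE
    · have hkt : IntervalIntegrable k volume a t :=
        hk.mono_set (Set.uIcc_subset_uIcc_left (by rwa [Set.uIcc_of_le hab]))
      rw [setLIntegral_hazard_density ht.1 hkt (fun v hv => hk0 v ⟨hv.1, hv.2.trans ht.2⟩) hB,
        Measure.map_apply hT measurableSet_Iic, cond_apply hE, hcdf t ht, hμE,
        ENNReal.ofReal_div_of_pos hB, ENNReal.div_eq_inv_mul]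

end HazardRate

section LosRate

variable {lamb R : ℝ} {pB : ℝ → ℝ} {u : Plane}

/-- The intensity, at distance `v` from a user at `u`, of the distances to the line-of-sight base
stations. -/
noncomputable def losRate (lamb R : ℝ) (pB : ℝ → ℝ) (u : Plane) (v : ℝ) : ℝ :=
  lamb * (arcLengthInDisk R u v * (1 - pB v))

theorem measurable_losRate (hpB : Measurable pB) (lamb R : ℝ) (u : Plane) :
    Measurable (losRate lamb R pB u) :=
  ((measurable_arcLengthInDisk R u).mul (hpB.const_sub 1)).const_mul lamb

theorem losRate_nonneg (hlamb : 0 ≤ lamb) (hpB : IsBlockageProfile pB) {v : ℝ} (hv : 0 ≤ v) :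
    0 ≤ losRate lamb R pB u v :=
  mul_nonneg hlamb <|
    mul_nonneg (arcLengthInDisk_nonneg R u hv) (sub_nonneg.mpr (hpB.mem_Icc v hv).2)

theorem losRate_le (hlamb : 0 ≤ lamb) (hpB : IsBlockageProfile pB) {v : ℝ} (hv : 0 ≤ v) :
    losRate lamb R pB u v ≤ lamb * (2 * Real.pi * v) := by
  refine mul_le_mul_of_nonneg_left ?_ hlamb
  refine (mul_le_of_le_one_right (arcLengthInDisk_nonneg R u hv) ?_).trans
    (arcLengthInDisk_le R u hv)
  exact sub_le_self _ (hpB.mem_Icc v hv).1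

theorem intervalIntegrable_losRate (hlamb : 0 ≤ lamb) (hpB : IsBlockageProfile pB) {a b : ℝ}
    (ha : 0 ≤ a) (hb : 0 ≤ b) : IntervalIntegrable (losRate lamb R pB u) volume a b := by
  have hdom : IntervalIntegrable (fun v => lamb * (2 * Real.pi * v)) volume a b :=
    Continuous.intervalIntegrable (by fun_prop) _ _
  refine hdom.mono_fun (measurable_losRate hpB.measurable lamb R u).aestronglyMeasurable ?_
  refine ae_restrict_of_forall_mem measurableSet_uIoc fun v hv => ?_
  have hv0 : 0 ≤ v := (le_min ha hb).trans hv.1.le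
  exact (Real.norm_of_nonneg (losRate_nonneg hlamb hpB hv0)).trans_le
    ((losRate_le hlamb hpB hv0).trans (le_abs_self _))

theorem integral_losRate_of_le {l : ℝ} (hl0 : 0 ≤ l) (hl : l ≤ R - ‖u‖) :
    ∫ v in 0..l, losRate lamb R pB u v =
      2 * Real.pi * lamb * ∫ v in 0..l, v * (1 - pB v) := by
  rw [← intervalIntegral.integral_const_mul]
  refine intervalIntegral.integral_congr fun v hv => ?_
  rw [Set.uIcc_of_le hl0] at hv
  simp only [losRate, arcLengthInDisk_of_le hv.1 (hv.2.trans hl)]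
  ring

theorem losRate_of_lt (hu : ‖u‖ ≤ R) {v : ℝ} (hv : R - ‖u‖ < v) :
    losRate lamb R pB u v = lamb * (C R v ‖u‖ * (1 - pB v)) := by
  rw [losRate, arcLengthInDisk_eq_C ((norm_nonneg u).trans hu)
    (by rwa [abs_of_nonneg (sub_nonneg.mpr hu)])]

theorem integral_losRate_of_ge (hlamb : 0 ≤ lamb) (hu : ‖u‖ ≤ R) (hpB : IsBlockageProfile pB)
    {l : ℝ} (hl : R - ‖u‖ ≤ l) :
    ∫ v in 0..l, losRate lamb R pB u v =
      lamb * ((2 * Real.pi * ∫ v in 0..(R - ‖u‖), v * (1 - pB v)) +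
        ∫ v in (R - ‖u‖)..l, C R v ‖u‖ * (1 - pB v)) := by
  have h0 : 0 ≤ R - ‖u‖ := sub_nonneg.mpr hu
  have houter : ∫ v in (R - ‖u‖)..l, losRate lamb R pB u v =
      lamb * ∫ v in (R - ‖u‖)..l, C R v ‖u‖ * (1 - pB v) := by
    rw [← intervalIntegral.integral_const_mul, intervalIntegral.integral_of_le hl,
      intervalIntegral.integral_of_le hl]
    exact setIntegral_congr_fun measurableSet_Ioc fun v hv => losRate_of_lt hu hv.1
  rw [← intervalIntegral.integral_add_adjacent_intervals
    (intervalIntegrable_losRate hlamb hpB le_rfl h0)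
    (intervalIntegrable_losRate hlamb hpB h0 (h0.trans hl)),
    integral_losRate_of_le h0 le_rfl, houter]
  ring

theorem B_L_eq (hlamb : 0 ≤ lamb) (hu : ‖u‖ ≤ R) (hpB : IsBlockageProfile pB) {r₀ : ℝ}
    (hr₀ : 0 ≤ r₀) :
    B_L lamb R r₀ pB ‖u‖ = 1 - Real.exp (-∫ v in 0..r₀, losRate lamb R pB u v) := by
  rw [B_L]
  split_ifs with h
  · rw [integral_losRate_of_le hr₀ (by linarith)]
  · rw [integral_losRate_of_ge hlamb hu hpB (by linarith)]

theorem f_L_eq (hlamb : 0 ≤ lamb) (hu : ‖u‖ ≤ R) (hpB : IsBlockageProfile pB) {r₀ l : ℝ}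
    (hl : l ∈ Set.Icc 0 r₀) :
    f_L lamb R r₀ pB l ‖u‖ =
      losRate lamb R pB u l * Real.exp (-∫ v in 0..l, losRate lamb R pB u v) /
        (1 - Real.exp (-∫ v in 0..r₀, losRate lamb R pB u v)) := by
  rw [f_L, ← B_L_eq hlamb hu hpB (hl.1.trans hl.2)]
  split_ifs with h
  · have hlR : l ≤ R - ‖u‖ := h.elim (fun h => by linarith [hl.2]) id
    rw [integral_losRate_of_le hl.1 hlR, losRate, arcLengthInDisk_of_le hl.1 hlR]
    ring
  · have hlR : R - ‖u‖ < l := not_le.mp fun hle => h (Or.inr hle)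
    rw [integral_losRate_of_ge hlamb hu hpB hlR.le, losRate_of_lt hu hlR]
    ring

end LosRate

section NearestLos

variable {Ω : Type*} {N : Ω → ℕ} {X : ℕ → Ω → Plane} {LOS : ℕ → Ω → Bool}

theorem losInRange_eq_compl_voidEvent (u : Plane) (t : ℝ) :
    losInRange N X LOS u t = (voidEvent N X LOS (Metric.closedBall u t))ᶜ := by
  ext ω
  simp [losInRange, losDistances, voidEvent, dist_comm u, and_assoc]

theorem finite_losDistances (u : Plane) (ω : Ω) : (losDistances N X LOS u ω).Finite := by
  refine ((Set.finite_Iio (N ω)).image fun i => dist u (X i ω)).subset ?_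
  rintro d ⟨i, hi, -, hd⟩
  exact ⟨i, hi, hd⟩

theorem nearestLosDist_nonneg (u : Plane) (ω : Ω) : 0 ≤ nearestLosDist N X LOS u ω := by
  refine Real.sInf_nonneg ?_
  rintro d ⟨i, -, -, rfl⟩
  exact dist_nonneg

theorem nearestLosDist_le_iff {u : Plane} {ω : Ω} (h : (losDistances N X LOS u ω).Nonempty)
    (t : ℝ) : nearestLosDist N X LOS u ω ≤ t ↔ ω ∈ losInRange N X LOS u t :=
  ⟨fun ht => ⟨_, h.csInf_mem (finite_losDistances u ω), ht⟩,
    fun ⟨_, hd, hdt⟩ => (csInf_le (finite_losDistances u ω).bddBelow hd).trans hdt⟩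

theorem losDistances_eq_empty_iff {u : Plane} {ω : Ω} :
    losDistances N X LOS u ω = ∅ ↔ ω ∈ voidEvent N X LOS Set.univ := by
  simp only [losDistances, voidEvent, Set.eq_empty_iff_forall_notMem, Set.mem_ofPred_eq,
    Set.mem_univ, not_true_eq_false]
  exact ⟨fun h i hi hl => h _ ⟨i, hi, hl, rfl⟩, fun h _ ⟨i, hi, hl, _⟩ => h i hi hl⟩

theorem losInRange_inter_nearestLosDist_le (u : Plane) (r₀ t : ℝ) :
    losInRange N X LOS u r₀ ∩ nearestLosDist N X LOS u ⁻¹' Set.Iic t =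
      losInRange N X LOS u (min t r₀) := by
  ext ω
  rcases (losDistances N X LOS u ω).eq_empty_or_nonempty with he | hne
  · simp [losInRange, he]
  · simp [← nearestLosDist_le_iff hne, and_comm]

theorem nearestLosDist_preimage_Iic (u : Plane) (t : ℝ) :
    nearestLosDist N X LOS u ⁻¹' Set.Iic t =
      losInRange N X LOS u t ∪ (voidEvent N X LOS Set.univ ∩ {_ω | 0 ≤ t}) := by
  ext ω
  rcases (losDistances N X LOS u ω).eq_empty_or_nonempty with he | hne
  · simp [nearestLosDist, losInRange, ← losDistances_eq_empty_iff (u := u), he]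
  · simp [nearestLosDist_le_iff hne, ← losDistances_eq_empty_iff (u := u), hne.ne_empty]

variable [MeasurableSpace Ω]

theorem measurableSet_losInRange (hN : Measurable N) (hX : ∀ i, Measurable (X i))
    (hLOS : ∀ i, Measurable (LOS i)) (u : Plane) (t : ℝ) :
    MeasurableSet (losInRange N X LOS u t) := by
  rw [losInRange_eq_compl_voidEvent]
  exact (measurableSet_voidEvent hN hX hLOS measurableSet_closedBall).compl

theorem measurable_nearestLosDist (hN : Measurable N) (hX : ∀ i, Measurable (X i))
    (hLOS : ∀ i, Measurable (LOS i)) (u : Plane) : Measurable (nearestLosDist N X LOS u) := by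
  refine measurable_of_Iic fun t => ?_
  rw [nearestLosDist_preimage_Iic]
  exact (measurableSet_losInRange hN hX hLOS u t).union
    ((measurableSet_voidEvent hN hX hLOS .univ).inter (.const _))

variable {μ : Measure Ω} [IsProbabilityMeasure μ] {lamb R : ℝ} {pB : ℝ → ℝ} {u : Plane}

theorem measure_losInRange (hlamb : 0 ≤ lamb) (hpB : IsBlockageProfile pB)
    (hX : IsPoissonProcess μ N X
      (ENNReal.ofReal lamb • volume.restrict (Metric.closedBall (0 : Plane) R)))
    (hLOS : IsIndependentMarking μ N X (fun x => 1 - pB (dist u x)) LOS) {t : ℝ} (ht : 0 ≤ t) :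
    μ (losInRange N X LOS u t) =
      ENNReal.ofReal (1 - Real.exp (-∫ v in 0..t, losRate lamb R pB u v)) := by
  have : IsFiniteMeasure (volume.restrict (Metric.closedBall (0 : Plane) R)) :=
    isFiniteMeasure_restrict.mpr measure_closedBall_lt_top.ne
  have : IsFiniteMeasure
      (ENNReal.ofReal lamb • volume.restrict (Metric.closedBall (0 : Plane) R)) :=
    Measure.smul_finite _ ENNReal.ofReal_ne_top
  have hq : Measurable fun x : Plane => 1 - pB (dist u x) :=
    (hpB.measurable.comp (by fun_prop)).const_sub 1
  have hq01 (x : Plane) : 1 - pB (dist u x) ∈ Set.Icc (0 : ℝ) 1 := by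
    obtain ⟨h0, h1⟩ := hpB.mem_Icc (dist u x) dist_nonneg
    exact ⟨sub_nonneg.mpr h1, sub_le_self _ h0⟩
  have hint : ∫ x in Metric.closedBall u t, (1 - pB (dist u x))
      ∂(ENNReal.ofReal lamb • volume.restrict (Metric.closedBall (0 : Plane) R)) =
      ∫ v in 0..t, losRate lamb R pB u v := by
    rw [Measure.restrict_smul, integral_smul_measure, ENNReal.toReal_ofReal hlamb, smul_eq_mul,
      setIntegral_closedBall_comp_dist R u ht (hpB.measurable.const_sub 1),
      ← intervalIntegral.integral_const_mul]
    rfl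
  rw [losInRange_eq_compl_voidEvent, prob_compl_eq_one_sub (measurableSet_voidEvent
      hX.measurable_number hX.measurable_point hLOS.measurable_mark measurableSet_closedBall),
    hX.measure_voidEvent hLOS hq hq01 measurableSet_closedBall, hint,
    ENNReal.ofReal_sub _ (Real.exp_pos _).le, ENNReal.ofReal_one]

theorem measureReal_losInRange (hlamb : 0 ≤ lamb) (hu : ‖u‖ ≤ R) (hpB : IsBlockageProfile pB)
    (hX : IsPoissonProcess μ N X
      (ENNReal.ofReal lamb • volume.restrict (Metric.closedBall (0 : Plane) R)))
    (hLOS : IsIndependentMarking μ N X (fun x => 1 - pB (dist u x)) LOS) {r₀ : ℝ}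
    (hr₀ : 0 ≤ r₀) : μ.real (losInRange N X LOS u r₀) = B_L lamb R r₀ pB ‖u‖ := by
  rw [measureReal_def, measure_losInRange hlamb hpB hX hLOS hr₀, B_L_eq hlamb hu hpB hr₀,
    ENNReal.toReal_ofReal]
  rw [sub_nonneg, Real.exp_le_one_iff, neg_nonpos]
  exact intervalIntegral.integral_nonneg hr₀ fun v hv => losRate_nonneg hlamb hpB hv.1

theorem map_nearestLosDist (hlamb : 0 ≤ lamb) (hu : ‖u‖ ≤ R) (hpB : IsBlockageProfile pB)
    (hX : IsPoissonProcess μ N X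
      (ENNReal.ofReal lamb • volume.restrict (Metric.closedBall (0 : Plane) R)))
    (hLOS : IsIndependentMarking μ N X (fun x => 1 - pB (dist u x)) LOS) {r₀ : ℝ}
    (hr₀ : 0 ≤ r₀) :
    (μ[|losInRange N X LOS u r₀]).map (nearestLosDist N X LOS u) =
      (volume.restrict (Set.Icc 0 r₀)).withDensity
        (fun l => ENNReal.ofReal (f_L lamb R r₀ pB l ‖u‖)) := by
  have hD := measurable_nearestLosDist hX.measurable_number hX.measurable_point
    hLOS.measurable_mark u
  have hE := measurableSet_losInRange hX.measurable_number hX.measurable_point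
    hLOS.measurable_mark u r₀
  have hDE : ∀ ω ∈ losInRange N X LOS u r₀, nearestLosDist N X LOS u ω ∈ Set.Icc 0 r₀ :=
    fun ω hω => ⟨nearestLosDist_nonneg u ω,
      (nearestLosDist_le_iff (hω.imp fun _ h => h.1) r₀).mpr hω⟩
  have hcdf : ∀ t ∈ Set.Icc 0 r₀,
      μ (losInRange N X LOS u r₀ ∩ nearestLosDist N X LOS u ⁻¹' Set.Iic t) =
        ENNReal.ofReal (1 - Real.exp (-∫ v in 0..t, losRate lamb R pB u v)) := fun t ht => by
    rw [losInRange_inter_nearestLosDist_le, min_eq_left ht.2,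
      measure_losInRange hlamb hpB hX hLOS ht.1]
  rw [map_cond_eq_withDensity_of_hazard hD hE hDE hr₀
    (intervalIntegrable_losRate hlamb hpB le_rfl hr₀)
    (fun v hv => losRate_nonneg hlamb hpB hv.1) hcdf]
  refine withDensity_congr_ae (ae_restrict_of_forall_mem measurableSet_Icc fun l hl => ?_)
  simp only [f_L_eq hlamb hu hpB hl]

end NearestLos

end MmWave

theorem proposition1 {Ω : Type*} [MeasurableSpace Ω] (μ : Measure Ω) [IsProbabilityMeasure μ]
    (lamb R r₀ : ℝ) (hlamb : 0 < lamb) (hR : 0 < R) (hr₀ : 0 < r₀)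
    (pB : ℝ → ℝ) (hpB : MmWave.IsBlockageProfile pB)
    (u : MmWave.Plane) (hu : u ∈ Metric.closedBall (0 : MmWave.Plane) R)
    (r : ℝ) (hr : r = ‖u‖)
    (N : Ω → ℕ) (X : ℕ → Ω → MmWave.Plane) (LOS : ℕ → Ω → Bool)
    (hX : MmWave.IsPoissonProcess μ N X
      (ENNReal.ofReal lamb • volume.restrict (Metric.closedBall (0 : MmWave.Plane) R)))
    (hLOS : MmWave.IsIndependentMarking μ N X (fun x => 1 - pB (dist u x)) LOS) :
    -- the probability of a line-of-sight base station within range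
    μ.real (MmWave.losInRange N X LOS u r₀) = MmWave.B_L lamb R r₀ pB r ∧
    -- the law of the distance to the nearest one, given that there is one within range
    (μ[|MmWave.losInRange N X LOS u r₀]).map (MmWave.nearestLosDist N X LOS u) =
      (volume.restrict (Set.Icc 0 r₀)).withDensity
        (fun l => ENNReal.ofReal (MmWave.f_L lamb R r₀ pB l r)) ∧
    -- the length of the part of the circle around the user that lies in the disk
    (∀ l, 0 ≤ l → l ≤ R - r → MmWave.arcLengthInDisk R u l = 2 * Real.pi * l) ∧
    (∀ l, R - r < l → MmWave.arcLengthInDisk R u l = MmWave.C R l r) ∧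
    -- the intersection points of the two circles, and the angle between the lines to them
    (∀ l, R - r < l → l < R + r →
      Metric.sphere (0 : MmWave.Plane) R ∩ Metric.sphere (!₂[0, r] : MmWave.Plane) l =
        {!₂[MmWave.x₁ R l r, MmWave.y₁₂ R l r], !₂[MmWave.x₂ R l r, MmWave.y₁₂ R l r]} ∧
      MmWave.theta R l r ∈ Set.Ioo 0 (2 * Real.pi) ∧
      (1 + MmWave.m₁ R l r * MmWave.m₂ R l r ≠ 0 →
        Real.tan (MmWave.theta R l r) =
          (MmWave.m₁ R l r - MmWave.m₂ R l r) / (1 + MmWave.m₁ R l r * MmWave.m₂ R l r))) := by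
  subst hr
  have hu' : ‖u‖ ≤ R := mem_closedBall_zero_iff.mp hu
  have habs : |R - ‖u‖| = R - ‖u‖ := abs_of_nonneg (sub_nonneg.mpr hu')
  refine ⟨MmWave.measureReal_losInRange hlamb.le hu' hpB hX hLOS hr₀.le,
    MmWave.map_nearestLosDist hlamb.le hu' hpB hX hLOS hr₀.le,
    fun l h0 h => MmWave.arcLengthInDisk_of_le h0 h,
    fun l h => MmWave.arcLengthInDisk_eq_C hR.le (habs.trans_lt h),
    fun l h1 h2 => ⟨MmWave.sphere_inter_sphere (habs.trans_lt h1) h2, MmWave.theta_mem_Ioo h2,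
      fun _ => MmWave.tan_theta h2⟩⟩
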